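/- Let $R$ be an associative ring with unit, $M$ a (left) $R$-module and $N$ a right $R$-module. An $R$-algebra is a ring $S$ with a ring homomorphism $R\to S$ (not required to be central). Let $\mathcal M(S)=S\otimes_R M$ and $\mathcal N(S)=N\otimes_R S$ be the quasi-coherent functors of modules, and right modules, on the category of $R$-algebras associated with $M$ and $N$; let $\mathcal M^\vee$ be the functor of right $\mathcal R$-modules $\mathcal M^\vee(S)=\operatorname{Hom}_{\mathcal R}(\mathcal M,\mathcal S)$, where $\mathcal S(S')=S'\otimes_R S$; here $\operatorname{Hom}_{\mathcal R}(\mathbb F,\mathbb G)$ is the group of natural families of $S$-linear maps $\mathbb F(S)\to\mathbb G(S)$. For an $R$-module $Q$ let $R\langle Q\rangle=T_R(Q\otimes_{\mathbb Z}R)$ be the $R$-algebra generated by $Q$, with $i_Q\colon Q\to R\langle Q\rangle$, $q\mapsto q\otimes 1$. Let $in,h_x\colon R\langle M\rangle\to R\langle M\oplus Rx\rangle$ be the morphisms of $R$-algebras with $in(m)=m$ and $h_x(m)=m\cdot x$ for $m\in M$, and let $$\mathcal N^r(M)=\{f\in\mathcal N(R\langle M\rangle) : \mathcal N(h_x)(f)=\mathcal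 N(in)(f)\cdot x\}.$$ Then there is an isomorphism of groups $$\operatorname{Hom}_{\mathcal R}(\mathcal M^\vee,\mathcal N)\;\xrightarrow{\ \sim\ }\;\mathcal N^r(M),\qquad \varphi\mapsto\varphi_{R\langle M\rangle}(i_M),$$ where $i_M$ is viewed as the element $\mathrm{id}\otimes i_M$ of $\mathcal M^\vee(R\langle M\rangle)$. Moreover the map $N\otimes_R M\otimes_{\mathbb Z}R\to N\otimes_R R\langle M\rangle$, $n\otimes m\otimes r\mapsto n\otimes (i_M(m)\, r)$, restricts to an isomorphism of groups $$\operatorname{Ker}\bigl[\,p_1-p_2\colon N\otimes_R M\otimes_{\mathbb Z}R\to N\otimes_R M\otimes_{\mathbb Z}R\otimes_{\mathbb Z}R\,\bigr]\;\xrightarrow{\ \sim\ }\;\mathcal N^r(M),$$ where $p_1(n\otimes m\otimes r)=n\otimes m\otimes r\otimes 1$ and $p_2(n\otimes m\otimes r)=n\otimes m\otimes 1\otimes r$. -/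

import Mathlib

open CategoryTheory
open scoped TensorProduct

universe u w w₁ w₂

noncomputable section

namespace FunctorModules

/-! ### The tensor product of a right module and a left module over a noncommutative ring -/

section Balanced

variable (R : Type*) [Ring R]
variable (N : Type*) [AddCommGroup N] [Module Rᵐᵒᵖ N]
variable (M : Type*) [AddCommGroup M] [Module R M]
variable {N₁ : Type*} [AddCommGroup N₁] [Module Rᵐᵒᵖ N₁]
variable {M₁ : Type*} [AddCommGroup M₁] [Module R M₁]
variable {N₂ : Type*} [AddCommGroup N₂] [Module Rᵐᵒᵖ N₂]
variable {M₂ : Type*} [AddCommGroup M₂] [Module R M₂]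

/-- The subgroup of `N ⊗_ℤ M` generated by the elements `n r ⊗ m - n ⊗ r m`. -/
def balancing : AddSubgroup (N ⊗[ℤ] M) :=
  AddSubgroup.closure
    {t | ∃ (n : N) (r : R) (m : M), t = (MulOpposite.op r • n) ⊗ₜ[ℤ] m - n ⊗ₜ[ℤ] (r • m)}

/-- `N ⊗_R M` for a right `R`-module `N` and a left `R`-module `M`: the quotient of
`N ⊗_ℤ M` by the relations `n r ⊗ m = n ⊗ r m`. -/
def BTensor : Type _ := (N ⊗[ℤ] M) ⧸ balancing R N M

instance : AddCommGroup (BTensor R N M) :=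
  inferInstanceAs (AddCommGroup ((N ⊗[ℤ] M) ⧸ balancing R N M))

variable {N M}

/-- The pure tensor `n ⊗ m` in `N ⊗_R M`. -/
def btmul (n : N) (m : M) : BTensor R N M :=
  QuotientAddGroup.mk' (balancing R N M) (n ⊗ₜ[ℤ] m)

variable {R}

theorem btmul_balanced (n : N) (r : R) (m : M) :
    btmul R (MulOpposite.op r • n) m = btmul R n (r • m) := by
  refine QuotientAddGroup.eq_iff_sub_mem.2 ?_
  exact AddSubgroup.subset_closure ⟨n, r, m, rfl⟩

theorem BTensor.addHom_ext {P : Type*} [AddCommGroup P] {f g : BTensor R N M →+ P}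
    (h : ∀ n m, f (btmul R n m) = g (btmul R n m)) : f = g := by
  apply QuotientAddGroup.addMonoidHom_ext
  ext t
  induction t with
  | zero => simp
  | tmul n m => exact h n m
  | add a b ha hb => rw [map_add, map_add, ha, hb]

/-- `f ⊗ g : N ⊗_R M → N₁ ⊗_R M₁`. -/
def BTensor.map (f : N →ₗ[Rᵐᵒᵖ] N₁) (g : M →ₗ[R] M₁) : BTensor R N M →+ BTensor R N₁ M₁ :=
  QuotientAddGroup.map (balancing R N M) (balancing R N₁ M₁)
    (TensorProduct.map f.toAddMonoidHom.toIntLinearMap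
      g.toAddMonoidHom.toIntLinearMap).toAddMonoidHom
    ((AddSubgroup.closure_le _).2 (by
      rintro _ ⟨n, r, m, rfl⟩
      apply AddSubgroup.subset_closure
      refine ⟨f n, r, g m, ?_⟩
      simp))

@[simp] theorem BTensor.map_btmul (f : N →ₗ[Rᵐᵒᵖ] N₁) (g : M →ₗ[R] M₁) (n : N) (m : M) :
    BTensor.map f g (btmul R n m) = btmul R (f n) (g m) := rfl

theorem btmul_add_left (n n' : N) (m : M) :
    btmul R (n + n') m = btmul R n m + btmul R n' m := by
  exact (congrArg (QuotientAddGroup.mk' (balancing R N M)) (TensorProduct.add_tmul n n' m)).trans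
    (map_add _ _ _)

theorem btmul_add_right (n : N) (m m' : M) :
    btmul R n (m + m') = btmul R n m + btmul R n m' := by
  exact (congrArg (QuotientAddGroup.mk' (balancing R N M)) (TensorProduct.tmul_add n m m')).trans
    (map_add _ _ _)

theorem BTensor.map_id :
    BTensor.map (LinearMap.id : N →ₗ[Rᵐᵒᵖ] N) (LinearMap.id : M →ₗ[R] M) = AddMonoidHom.id _ :=
  BTensor.addHom_ext fun _ _ => rfl

theorem BTensor.map_comp (f : N →ₗ[Rᵐᵒᵖ] N₁) (g : M →ₗ[R] M₁)
    (f' : N₁ →ₗ[Rᵐᵒᵖ] N₂) (g' : M₁ →ₗ[R] M₂) :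
    (BTensor.map f' g').comp (BTensor.map f g) = BTensor.map (f' ∘ₗ f) (g' ∘ₗ g) :=
  BTensor.addHom_ext fun _ _ => rfl

theorem BTensor.map_map (f : N →ₗ[Rᵐᵒᵖ] N₁) (g : M →ₗ[R] M₁)
    (f' : N₁ →ₗ[Rᵐᵒᵖ] N₂) (g' : M₁ →ₗ[R] M₂) (x : BTensor R N M) :
    BTensor.map f' g' (BTensor.map f g x) = BTensor.map (f' ∘ₗ f) (g' ∘ₗ g) x :=
  DFunLike.congr_fun (BTensor.map_comp f g f' g') x

theorem BTensor.map_congr {f f' : N →ₗ[Rᵐᵒᵖ] N₁} {g g' : M →ₗ[R] M₁} (hf : ∀ n, f n = f' n)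
    (hg : ∀ m, g m = g' m) (x : BTensor R N M) : BTensor.map f g x = BTensor.map f' g' x := by
  rw [LinearMap.ext hf, LinearMap.ext hg]

theorem BTensor.map_map_congr {N₃ M₃ : Type*} [AddCommGroup N₃] [Module Rᵐᵒᵖ N₃]
    [AddCommGroup M₃] [Module R M₃]
    {f : N →ₗ[Rᵐᵒᵖ] N₁} {g : M →ₗ[R] M₁} {f' : N₁ →ₗ[Rᵐᵒᵖ] N₂} {g' : M₁ →ₗ[R] M₂}
    {k : N →ₗ[Rᵐᵒᵖ] N₃} {l : M →ₗ[R] M₃} {k' : N₃ →ₗ[Rᵐᵒᵖ] N₂} {l' : M₃ →ₗ[R] M₂}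
    (hf : ∀ n, f' (f n) = k' (k n)) (hg : ∀ m, g' (g m) = l' (l m)) (x : BTensor R N M) :
    BTensor.map f' g' (BTensor.map f g x) = BTensor.map k' l' (BTensor.map k l x) := by
  rw [BTensor.map_map, BTensor.map_map]
  exact BTensor.map_congr hf hg x

theorem BTensor.map_add_left (f f' : N →ₗ[Rᵐᵒᵖ] N₁) (g : M →ₗ[R] M₁) :
    BTensor.map (f + f') g = BTensor.map f g + BTensor.map f' g :=
  BTensor.addHom_ext fun n m => btmul_add_left (f n) (f' n) (g m)

theorem BTensor.map_add_right (f : N →ₗ[Rᵐᵒᵖ] N₁) (g g' : M →ₗ[R] M₁) :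
    BTensor.map f (g + g') = BTensor.map f g + BTensor.map f g' :=
  BTensor.addHom_ext fun n m => btmul_add_right (f n) (g m) (g' m)

theorem BTensor.map_zero_left (g : M →ₗ[R] M₁) :
    BTensor.map (0 : N →ₗ[Rᵐᵒᵖ] N₁) g = 0 := by
  simpa using BTensor.map_add_left (0 : N →ₗ[Rᵐᵒᵖ] N₁) 0 g

theorem BTensor.map_zero_right (f : N →ₗ[Rᵐᵒᵖ] N₁) :
    BTensor.map f (0 : M →ₗ[R] M₁) = 0 := by
  simpa using BTensor.map_add_right f (0 : M →ₗ[R] M₁) 0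

/-- If `A` acts on `N` commuting with the right `R`-action, then `A` acts on `N ⊗_R M` by
`a (n ⊗ m) = (a n) ⊗ m`. -/
abbrev BTensor.moduleLeft (A : Type*) [Ring A] [Module A N] [SMulCommClass A Rᵐᵒᵖ N] :
    Module A (BTensor R N M) where
  smul a x := BTensor.map (DistribSMul.toLinearMap Rᵐᵒᵖ N a) LinearMap.id x
  one_smul x := by
    change BTensor.map _ _ x = x
    conv_rhs => rw [← AddMonoidHom.id_apply _ x, ← BTensor.map_id]
    congr 2; ext n; simp
  mul_smul a b x := by
    change BTensor.map _ _ x = BTensor.map _ _ (BTensor.map _ _ x)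
    rw [BTensor.map_map]
    congr 2; ext n; simp [mul_smul]
  smul_zero a := map_zero _
  smul_add a := map_add _
  add_smul a b x := by
    change BTensor.map _ _ x = BTensor.map _ _ x + BTensor.map _ _ x
    rw [← AddMonoidHom.add_apply, ← BTensor.map_add_left]
    congr 2; ext n; simp [add_smul]
  zero_smul x := by
    change BTensor.map _ _ x = 0
    conv_rhs => rw [← AddMonoidHom.zero_apply x, ← BTensor.map_zero_left LinearMap.id]
    congr 2; ext n; simp

/-- If `A` acts on `M` commuting with the left `R`-action, then `A` acts on `N ⊗_R M` by
`a (n ⊗ m) = n ⊗ (a m)`. For `A = Sᵐᵒᵖ` this is a right `S`-module structure. -/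
abbrev BTensor.moduleRight (A : Type*) [Ring A] [Module A M] [SMulCommClass A R M] :
    Module A (BTensor R N M) where
  smul a x := BTensor.map LinearMap.id (DistribSMul.toLinearMap R M a) x
  one_smul x := by
    change BTensor.map _ _ x = x
    conv_rhs => rw [← AddMonoidHom.id_apply _ x, ← BTensor.map_id]
    congr 2; ext n; simp
  mul_smul a b x := by
    change BTensor.map _ _ x = BTensor.map _ _ (BTensor.map _ _ x)
    rw [BTensor.map_map]
    congr 2; ext n; simp [mul_smul]
  smul_zero a := map_zero _
  smul_add a := map_add _
  add_smul a b x := by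
    change BTensor.map _ _ x = BTensor.map _ _ x + BTensor.map _ _ x
    rw [← AddMonoidHom.add_apply, ← BTensor.map_add_right]
    congr 2; ext n; simp [add_smul]
  zero_smul x := by
    change BTensor.map _ _ x = 0
    conv_rhs => rw [← AddMonoidHom.zero_apply x, ← BTensor.map_zero_right LinearMap.id]
    congr 2; ext n; simp

end Balanced

/-! ### `R`-algebras over a noncommutative ring -/

/-- The category of `R`-algebras: rings `S` with a ring homomorphism `R → S`
(not required to be central). -/
abbrev RAlg (R : Type u) [Ring R] := Under (RingCat.of R)

section RAlg

variable {R : Type u} [Ring R] (S : RAlg R)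

/-- The structure morphism `R → S`. -/
def structMap : R →+* S.right := S.hom.hom

/-- `S` as a left `R`-module. -/
instance : Module R S.right := Module.compHom S.right (structMap S)

/-- `S` as a right `R`-module. -/
instance : Module Rᵐᵒᵖ S.right := Module.compHom S.right (RingHom.op (structMap S))

theorem smul_left_def (r : R) (s : S.right) : r • s = structMap S r * s := rfl

theorem smul_right_def (r : R) (s : S.right) :
    MulOpposite.op r • s = s * structMap S r := rfl

/-- `S` is an `(S, R)`-bimodule. -/
instance : SMulCommClass S.right Rᵐᵒᵖ S.right where
  smul_comm s r t := by
    induction r with | _ r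
    simp only [smul_right_def, smul_eq_mul, mul_assoc]

/-- `S` is an `(R, S)`-bimodule. -/
instance : SMulCommClass S.rightᵐᵒᵖ R S.right where
  smul_comm s r t := by
    simp only [smul_left_def, MulOpposite.smul_eq_mul_unop, mul_assoc]

variable {S} {T : RAlg R}

theorem right_structMap (f : S ⟶ T) (r : R) : f.right (structMap S r) = structMap T r :=
  DFunLike.congr_fun (congrArg RingCat.Hom.hom (Under.w f)) r

/-- A morphism of `R`-algebras as a morphism of left `R`-modules. -/
def algLeft (f : S ⟶ T) : S.right →ₗ[R] T.right where
  toFun s := f.right s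
  map_add' := map_add f.right.hom
  map_smul' r s := by
    simp only [smul_left_def, RingHom.id_apply, map_mul, right_structMap]

/-- A morphism of `R`-algebras as a morphism of right `R`-modules. -/
def algRight (f : S ⟶ T) : S.right →ₗ[Rᵐᵒᵖ] T.right where
  toFun s := f.right s
  map_add' := map_add f.right.hom
  map_smul' r s := by
    induction r with | _ r
    simp only [smul_right_def, RingHom.id_apply, map_mul, right_structMap]

end RAlg

/-! ### Functors of (left and right) `𝓡`-modules and their morphisms -/

/-- A functor of `𝓡`-modules: a functor `𝕄` from `R`-algebras to abelian groups with an
`S`-module structure on each `𝕄(S)`, the action `𝓡 × 𝕄 → 𝕄` being natural. -/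
structure LeftFunctor (R : Type u) [Ring R] where
  /-- the underlying functor -/
  fn : RAlg R ⥤ AddCommGrpCat.{w}
  /-- the module structures -/
  module (S : RAlg R) : Module S.right (fn.obj S)
  map_smul {S T : RAlg R} (f : S ⟶ T) (s : S.right) (x : fn.obj S) :
    fn.map f (s • x) = (f.right s : T.right) • fn.map f x

/-- A functor of right `𝓡`-modules. -/
structure RightFunctor (R : Type u) [Ring R] where
  /-- the underlying functor -/
  fn : RAlg R ⥤ AddCommGrpCat.{w}
  /-- the right module structures -/
  module (S : RAlg R) : Module S.rightᵐᵒᵖ (fn.obj S)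
  map_smul {S T : RAlg R} (f : S ⟶ T) (s : S.right) (x : fn.obj S) :
    fn.map f (MulOpposite.op s • x) = MulOpposite.op (f.right s : T.right) • fn.map f x

attribute [instance] LeftFunctor.module RightFunctor.module

/-- `Hom_𝓡(F, G)` for functors of `𝓡`-modules: the group of families of `S`-linear maps
`F(S) → G(S)` which are natural in the `R`-algebra `S`. -/
def LeftFunctor.hom {R : Type u} [Ring R] (F : LeftFunctor.{u, w₁} R)
    (G : LeftFunctor.{u, w₂} R) : AddSubgroup ((S : RAlg R) → (F.fn.obj S →+ G.fn.obj S)) where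
  carrier := {φ |
    (∀ (S : RAlg R) (s : S.right) (x : F.fn.obj S), φ S (s • x) = s • φ S x) ∧
    (∀ (S T : RAlg R) (f : S ⟶ T) (x : F.fn.obj S), φ T (F.fn.map f x) = G.fn.map f (φ S x))}
  zero_mem' := ⟨fun _ _ _ => by simp, fun _ _ _ _ => by simp⟩
  add_mem' := fun {a b} ha hb => ⟨fun S s x => by simp [ha.1, hb.1],
    fun S T f x => by simp [ha.2, hb.2]⟩
  neg_mem' := fun {a} ha => ⟨fun S s x => by simp [ha.1], fun S T f x => by simp [ha.2]⟩

/-- `Hom_𝓡(F, G)` for functors of right `𝓡`-modules. -/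
def RightFunctor.hom {R : Type u} [Ring R] (F : RightFunctor.{u, w₁} R)
    (G : RightFunctor.{u, w₂} R) : AddSubgroup ((S : RAlg R) → (F.fn.obj S →+ G.fn.obj S)) where
  carrier := {φ |
    (∀ (S : RAlg R) (s : S.right) (x : F.fn.obj S),
      φ S (MulOpposite.op s • x) = MulOpposite.op s • φ S x) ∧
    (∀ (S T : RAlg R) (f : S ⟶ T) (x : F.fn.obj S), φ T (F.fn.map f x) = G.fn.map f (φ S x))}
  zero_mem' := ⟨fun _ _ _ => by simp, fun _ _ _ _ => by simp⟩
  add_mem' := fun {a b} ha hb => ⟨fun S s x => by simp [ha.1, hb.1],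
    fun S T f x => by simp [ha.2, hb.2]⟩
  neg_mem' := fun {a} ha => ⟨fun S s x => by simp [ha.1], fun S T f x => by simp [ha.2]⟩

/-! ### Quasi-coherent modules -/

section QuasiCoherent

variable (R : Type u) [Ring R]

/-- The left `S`-module structure of `S ⊗_R M`. -/
instance (S : RAlg R) (M : Type u) [AddCommGroup M] [Module R M] :
    Module S.right (BTensor R S.right M) := BTensor.moduleLeft S.right

/-- The right `S`-module structure of `N ⊗_R S`. -/
instance (S : RAlg R) (N : Type u) [AddCommGroup N] [Module Rᵐᵒᵖ N] :
    Module S.rightᵐᵒᵖ (BTensor R N S.right) := BTensor.moduleRight S.rightᵐᵒᵖ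

/-- The quasi-coherent `𝓡`-module `𝓜(S) = S ⊗_R M` associated with a left `R`-module `M`. -/
def quasiCoherent (M : Type u) [AddCommGroup M] [Module R M] : LeftFunctor.{u, u} R where
  fn :=
    { obj := fun S => AddCommGrpCat.of (BTensor R S.right M)
      map := fun f => AddCommGrpCat.ofHom (BTensor.map (algRight f) LinearMap.id)
      map_id := fun S => by
        ext1
        exact BTensor.map_id
      map_comp := fun f g => by
        ext1
        exact (BTensor.map_comp (algRight f) LinearMap.id (algRight g) LinearMap.id).symm }
  module S := (inferInstance : Module S.right (BTensor R S.right M))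
  map_smul {S T} f s x :=
    BTensor.map_map_congr (f := DistribSMul.toLinearMap Rᵐᵒᵖ S.right s) (g := LinearMap.id)
      (f' := algRight f) (g' := LinearMap.id) (k := algRight f) (l := LinearMap.id)
      (k' := DistribSMul.toLinearMap Rᵐᵒᵖ T.right (f.right s)) (l' := LinearMap.id)
      (fun t => map_mul f.right.hom s t) (fun _ => rfl) x

/-- The quasi-coherent right `𝓡`-module `𝓝(S) = N ⊗_R S` associated with a right
`R`-module `N`. -/
def quasiCoherentRight (N : Type u) [AddCommGroup N] [Module Rᵐᵒᵖ N] :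
    RightFunctor.{u, u} R where
  fn :=
    { obj := fun S => AddCommGrpCat.of (BTensor R N S.right)
      map := fun f => AddCommGrpCat.ofHom (BTensor.map LinearMap.id (algLeft f))
      map_id := fun S => by
        ext1
        exact BTensor.map_id
      map_comp := fun f g => by
        ext1
        exact (BTensor.map_comp LinearMap.id (algLeft f) LinearMap.id (algLeft g)).symm }
  module S := (inferInstance : Module S.rightᵐᵒᵖ (BTensor R N S.right))
  map_smul {S T} f s x :=
    BTensor.map_map_congr (f := LinearMap.id)
      (g := DistribSMul.toLinearMap R S.right (MulOpposite.op (s : S.right)))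
      (f' := LinearMap.id) (g' := algLeft f) (k := LinearMap.id) (l := algLeft f)
      (k' := LinearMap.id)
      (l' := DistribSMul.toLinearMap R T.right (MulOpposite.op (f.right s : T.right)))
      (fun _ => rfl) (fun t => map_mul f.right.hom t s) x

variable {R}
variable {M P Q : Type u} [AddCommGroup M] [Module R M] [AddCommGroup P] [Module R P]
  [AddCommGroup Q] [Module R Q]

/-- The morphism `𝓜 → 𝓟` induced by a morphism of `R`-modules `g : M → P`, namely
`id ⊗ g : S ⊗_R M → S ⊗_R P` on each `R`-algebra `S`. -/
def quasiCoherentMap (g : M →ₗ[R] P) : (quasiCoherent R M).hom (quasiCoherent R P) where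
  val S := BTensor.map (LinearMap.id : S.right →ₗ[Rᵐᵒᵖ] S.right) g
  property := by
    refine ⟨fun S s x => ?_, fun S T f x => ?_⟩
    · exact BTensor.map_map_congr (f := DistribSMul.toLinearMap Rᵐᵒᵖ S.right s)
        (g := (LinearMap.id : M →ₗ[R] M)) (f' := LinearMap.id) (g' := g) (k := LinearMap.id)
        (l := g) (k' := DistribSMul.toLinearMap Rᵐᵒᵖ S.right s) (l' := LinearMap.id)
        (fun _ => rfl) (fun _ => rfl) x
    · exact BTensor.map_map_congr (f := algRight f)
        (g := (LinearMap.id : M →ₗ[R] M)) (f' := LinearMap.id) (g' := g) (k := LinearMap.id)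
        (l := g) (k' := algRight f) (l' := LinearMap.id)
        (fun _ => rfl) (fun _ => rfl) x

/-- Composition of a morphism `F → 𝓟` with the morphism `𝓟 → 𝓠` induced by `g : P → Q`. -/
def postcomp (F : LeftFunctor.{u, w} R) (g : P →ₗ[R] Q) :
    F.hom (quasiCoherent R P) →+ F.hom (quasiCoherent R Q) where
  toFun φ := ⟨fun S => ((quasiCoherentMap g).1 S).comp (φ.1 S), by
    refine ⟨fun S s x => ?_, fun S T f x => ?_⟩
    · simp only [AddMonoidHom.comp_apply]
      rw [φ.2.1, (quasiCoherentMap g).2.1]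
    · simp only [AddMonoidHom.comp_apply]
      rw [φ.2.2, (quasiCoherentMap g).2.2]⟩
  map_zero' := by
    apply Subtype.ext; funext S; ext x
    exact map_zero ((quasiCoherentMap g).1 S)
  map_add' a b := by
    apply Subtype.ext; funext S; ext x
    exact map_add ((quasiCoherentMap g).1 S) _ _

theorem postcomp_apply (F : LeftFunctor.{u, w} R) (g : P →ₗ[R] Q)
    (φ : F.hom (quasiCoherent R P)) (S : RAlg R) (x : F.fn.obj S) :
    (postcomp F g φ).1 S x =
      BTensor.map (LinearMap.id : S.right →ₗ[Rᵐᵒᵖ] S.right) g (φ.1 S x) := rfl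

end QuasiCoherent

/-! ### The dual functor -/

section Dual

variable {R : Type u} [Ring R] (F : LeftFunctor.{u, w} R)

/-- Right multiplication by `s` on `S`, a morphism of left `R`-modules. -/
def rmul (S : RAlg R) (s : S.rightᵐᵒᵖ) : S.right →ₗ[R] S.right :=
  DistribSMul.toLinearMap R S.right s

/-- The right `S`-module structure on `Hom_𝓡(F, 𝓢)`, induced by right multiplication on `S`. -/
instance dualModule (S : RAlg R) : Module S.rightᵐᵒᵖ (F.hom (quasiCoherent R S.right)) where
  smul s φ := postcomp F (rmul S s) φ
  one_smul φ := by
    apply Subtype.ext; funext T; ext x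
    exact (BTensor.map_congr (f' := LinearMap.id) (g' := LinearMap.id) (fun _ => rfl)
      (fun n => one_smul S.rightᵐᵒᵖ n) (φ.1 T x)).trans (DFunLike.congr_fun BTensor.map_id (φ.1 T x))
  mul_smul a b φ := by
    apply Subtype.ext; funext T; ext x
    exact (BTensor.map_congr (f' := LinearMap.id) (g' := rmul S a ∘ₗ rmul S b) (fun _ => rfl)
      (fun n => mul_smul a b n) (φ.1 T x)).trans
      (BTensor.map_map LinearMap.id (rmul S b) LinearMap.id (rmul S a) (φ.1 T x)).symm
  smul_zero a := map_zero _
  smul_add a := map_add _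
  add_smul a b φ := by
    apply Subtype.ext; funext T; ext x
    exact (BTensor.map_congr (f' := LinearMap.id) (g' := rmul S a + rmul S b) (fun _ => rfl)
      (fun n => add_smul a b n) (φ.1 T x)).trans
      (DFunLike.congr_fun (BTensor.map_add_right LinearMap.id (rmul S a) (rmul S b)) (φ.1 T x))
  zero_smul φ := by
    apply Subtype.ext; funext T; ext x
    exact (BTensor.map_congr (f' := LinearMap.id) (g' := 0) (fun _ => rfl)
      (fun n => zero_smul S.rightᵐᵒᵖ n) (φ.1 T x)).trans
      (DFunLike.congr_fun (BTensor.map_zero_right LinearMap.id) (φ.1 T x))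

/-- The dual `F^∨(S) = Hom_𝓡(F, 𝓢)`, where `𝓢` is the quasi-coherent module associated
with the `R`-module `S`; it is a functor of right `𝓡`-modules. -/
def LeftFunctor.dual : RightFunctor.{u, max (u + 1) w} R where
  fn :=
    { obj := fun S => AddCommGrpCat.of (F.hom (quasiCoherent R S.right))
      map := fun f => AddCommGrpCat.ofHom (postcomp F (algLeft f))
      map_id := fun S => by
        ext1
        refine AddMonoidHom.ext fun φ => ?_
        apply Subtype.ext; funext T; ext x
        exact DFunLike.congr_fun BTensor.map_id (φ.1 T x)
      map_comp := fun f g => by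
        ext1
        refine AddMonoidHom.ext fun φ => ?_
        apply Subtype.ext; funext T; ext x
        exact (BTensor.map_map LinearMap.id (algLeft f) LinearMap.id (algLeft g) (φ.1 T x)).symm }
  module S := (inferInstance : Module S.rightᵐᵒᵖ (F.hom (quasiCoherent R S.right)))
  map_smul {S T} f s φ := by
    apply Subtype.ext; funext A; ext x
    exact BTensor.map_map_congr (f := LinearMap.id) (g := rmul S (MulOpposite.op (s : S.right)))
      (f' := LinearMap.id) (g' := algLeft f) (k := LinearMap.id) (l := algLeft f)
      (k' := LinearMap.id) (l' := rmul T (MulOpposite.op (f.right s : T.right)))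
      (fun _ => rfl) (fun t => map_mul f.right.hom t s) (φ.1 A x)

/-- The element of `𝓜^∨(S) = Hom_𝓡(𝓜, 𝓢)` induced by a morphism of `R`-modules `g : M → S`. -/
def dualPoint {M : Type u} [AddCommGroup M] [Module R M] {S : RAlg R} (g : M →ₗ[R] S.right) :
    (quasiCoherent R M).dual.fn.obj S :=
  quasiCoherentMap g

end Dual

/-! ### The `R`-algebra `R⟨M⟩` generated by an `R`-module `M` -/

section TensorRing

variable (R : Type u) [Ring R] (B : Type u) [AddCommGroup B] [Module R B] [Module Rᵐᵒᵖ B]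

/-- Relations defining the tensor ring of an `R`-bimodule `B` on the generators `R ⊔ B`. -/
inductive TensorRing.Rel : FreeAlgebra ℤ (R ⊕ B) → FreeAlgebra ℤ (R ⊕ B) → Prop
  | one : Rel (FreeAlgebra.ι ℤ (Sum.inl 1)) 1
  | add (r s : R) : Rel (FreeAlgebra.ι ℤ (Sum.inl (r + s)))
      (FreeAlgebra.ι ℤ (Sum.inl r) + FreeAlgebra.ι ℤ (Sum.inl s))
  | mul (r s : R) : Rel (FreeAlgebra.ι ℤ (Sum.inl (r * s)))
      (FreeAlgebra.ι ℤ (Sum.inl r) * FreeAlgebra.ι ℤ (Sum.inl s))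
  | badd (b c : B) : Rel (FreeAlgebra.ι ℤ (Sum.inr (b + c)))
      (FreeAlgebra.ι ℤ (Sum.inr b) + FreeAlgebra.ι ℤ (Sum.inr c))
  | left (r : R) (b : B) : Rel (FreeAlgebra.ι ℤ (Sum.inr (r • b)))
      (FreeAlgebra.ι ℤ (Sum.inl r) * FreeAlgebra.ι ℤ (Sum.inr b))
  | right (b : B) (r : R) : Rel (FreeAlgebra.ι ℤ (Sum.inr (MulOpposite.op r • b)))
      (FreeAlgebra.ι ℤ (Sum.inr b) * FreeAlgebra.ι ℤ (Sum.inl r))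

/-- The tensor ring `T_R(B)` of an `R`-bimodule `B`: the ring generated by `R` and `B`
subject to the ring relations of `R` and the bimodule relations of `B`. -/
def TensorRing : Type u := RingQuot (TensorRing.Rel R B)

instance : Ring (TensorRing R B) := inferInstanceAs (Ring (RingQuot (TensorRing.Rel R B)))

/-- The ring homomorphism `R → T_R(B)`. -/
def TensorRing.ofBase : R →+* TensorRing R B where
  toFun r := RingQuot.mkRingHom (TensorRing.Rel R B) (FreeAlgebra.ι ℤ (Sum.inl r))
  map_one' := by
    rw [RingQuot.mkRingHom_rel TensorRing.Rel.one, map_one]; rfl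
  map_mul' r s := by
    rw [RingQuot.mkRingHom_rel (TensorRing.Rel.mul r s), map_mul]; rfl
  map_zero' := by
    have h := RingQuot.mkRingHom_rel (TensorRing.Rel.add (R := R) (B := B) 0 0)
    rw [map_add, add_zero] at h
    exact left_eq_add.1 h
  map_add' r s := by
    rw [RingQuot.mkRingHom_rel (TensorRing.Rel.add r s), map_add]; rfl

/-- The inclusion of the generators `B → T_R(B)`. -/
def TensorRing.ofBimod : B →+ TensorRing R B :=
  AddMonoidHom.mk' (fun b => RingQuot.mkRingHom (TensorRing.Rel R B) (FreeAlgebra.ι ℤ (Sum.inr b)))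
    fun b c => by
      rw [RingQuot.mkRingHom_rel (TensorRing.Rel.badd b c), map_add]; rfl

variable {R B}

theorem TensorRing.ofBimod_left (r : R) (b : B) :
    TensorRing.ofBimod R B (r • b) = TensorRing.ofBase R B r * TensorRing.ofBimod R B b :=
  (RingQuot.mkRingHom_rel (TensorRing.Rel.left r b)).trans (map_mul _ _ _)

theorem TensorRing.ofBimod_right (r : R) (b : B) :
    TensorRing.ofBimod R B (MulOpposite.op r • b) =
      TensorRing.ofBimod R B b * TensorRing.ofBase R B r :=
  (RingQuot.mkRingHom_rel (TensorRing.Rel.right b r)).trans (map_mul _ _ _)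

/-- Universal property of `T_R(B)`: a ring homomorphism `σ : R → A` together with a
morphism of bimodules `g : B → A` extends to `T_R(B)`. -/
def TensorRing.lift {A : Type u} [Ring A] (σ : R →+* A) (g : B →+ A)
    (hl : ∀ r b, g (r • b) = σ r * g b) (hr : ∀ r b, g (MulOpposite.op r • b) = g b * σ r) :
    TensorRing R B →+* A :=
  RingQuot.lift ⟨(FreeAlgebra.lift ℤ (Sum.elim (⇑σ) (⇑g))).toRingHom, by
    intro x y h
    induction h with
    | one => simp
    | add r s => simp
    | mul r s => simp
    | badd b c => simp
    | left r b => simp [hl]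
    | right b r => simp [hr]⟩

theorem TensorRing.lift_ofBase {A : Type u} [Ring A] (σ : R →+* A) (g : B →+ A)
    (hl : ∀ r b, g (r • b) = σ r * g b) (hr : ∀ r b, g (MulOpposite.op r • b) = g b * σ r) (r : R) :
    TensorRing.lift σ g hl hr (TensorRing.ofBase R B r) = σ r := by
  refine (RingQuot.lift_mkRingHom_apply _ _ _).trans ?_
  simp

theorem TensorRing.lift_ofBimod {A : Type u} [Ring A] (σ : R →+* A) (g : B →+ A)
    (hl : ∀ r b, g (r • b) = σ r * g b) (hr : ∀ r b, g (MulOpposite.op r • b) = g b * σ r) (b : B) :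
    TensorRing.lift σ g hl hr (TensorRing.ofBimod R B b) = g b := by
  refine (RingQuot.lift_mkRingHom_apply _ _ _).trans ?_
  simp

theorem TensorRing.hom_ext {A : Type u} [Ring A] {f g : TensorRing R B →+* A}
    (h₁ : ∀ r, f (TensorRing.ofBase R B r) = g (TensorRing.ofBase R B r))
    (h₂ : ∀ b, f (TensorRing.ofBimod R B b) = g (TensorRing.ofBimod R B b)) : f = g := by
  apply RingQuot.ringQuot_ext
  have : (f.comp (RingQuot.mkRingHom (TensorRing.Rel R B))).toIntAlgHom =
      (g.comp (RingQuot.mkRingHom (TensorRing.Rel R B))).toIntAlgHom := by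
    apply FreeAlgebra.hom_ext
    funext x
    cases x with
    | inl r => exact h₁ r
    | inr b => exact h₂ b
  exact RingHom.ext fun x => DFunLike.congr_fun this x

end TensorRing

section FreeAlg

variable (R : Type u) [Ring R] (M : Type u) [AddCommGroup M] [Module R M]

/-- The right `R`-module structure of `M ⊗_ℤ R`: `(m ⊗ t) r = m ⊗ (t r)`. -/
abbrev tensorRightModule : Module Rᵐᵒᵖ (M ⊗[ℤ] R) where
  smul r b := TensorProduct.map (LinearMap.id : M →ₗ[ℤ] M) (DistribSMul.toLinearMap ℤ R r) b
  one_smul b := by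
    change TensorProduct.map _ _ b = b
    have h : DistribSMul.toLinearMap ℤ R (1 : Rᵐᵒᵖ) = LinearMap.id := by ext; simp
    rw [h, TensorProduct.map_id, LinearMap.id_apply]
  mul_smul r s b := by
    change TensorProduct.map _ _ b = TensorProduct.map _ _ (TensorProduct.map _ _ b)
    rw [← LinearMap.comp_apply, ← TensorProduct.map_comp]
    congr 2; ext; simp [mul_assoc]
  smul_zero r := map_zero _
  smul_add r := map_add _
  add_smul r s b := by
    change TensorProduct.map _ _ b = TensorProduct.map _ _ b + TensorProduct.map _ _ b
    rw [← LinearMap.add_apply, ← TensorProduct.map_add_right]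
    congr 2; ext; simp [mul_add]
  zero_smul b := by
    change TensorProduct.map _ _ b = 0
    have h : DistribSMul.toLinearMap ℤ R (0 : Rᵐᵒᵖ) = 0 := by ext; simp
    rw [h, TensorProduct.map_zero_right, LinearMap.zero_apply]

/-- The `R`-bimodule `M ⊗_ℤ R`, with `r (m ⊗ t) r' = (r m) ⊗ (t r')`. -/
def FreeBimod : Type u := M ⊗[ℤ] R

instance : AddCommGroup (FreeBimod R M) := inferInstanceAs (AddCommGroup (M ⊗[ℤ] R))

instance : Module R (FreeBimod R M) := inferInstanceAs (Module R (M ⊗[ℤ] R))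

instance : Module Rᵐᵒᵖ (FreeBimod R M) := tensorRightModule R M

/-- The `R`-algebra `R⟨M⟩ = T_R(M ⊗_ℤ R)` generated by the `R`-module `M`. -/
def freeAlg : RAlg R :=
  Under.mk (RingCat.ofHom (TensorRing.ofBase R (FreeBimod R M)))

variable {R M}

/-- The morphism of `R`-modules `i_M : M → R⟨M⟩`, `m ↦ m ⊗ 1`. -/
def freeAlg.ι : M →ₗ[R] (freeAlg R M).right where
  toFun m := TensorRing.ofBimod R (FreeBimod R M) (m ⊗ₜ[ℤ] (1 : R) : M ⊗[ℤ] R)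
  map_add' m m' := by
    rw [TensorProduct.add_tmul]
    exact map_add (TensorRing.ofBimod R (FreeBimod R M)) _ _
  map_smul' r m := TensorRing.ofBimod_left (B := FreeBimod R M) r (m ⊗ₜ[ℤ] (1 : R) : M ⊗[ℤ] R)

/-- The morphism of bimodules `M ⊗_ℤ R → S`, `m ⊗ r ↦ g(m) r`. -/
def freeBimodLift {S : RAlg R} (g : M →ₗ[R] S.right) : M ⊗[ℤ] R →+ S.right :=
  TensorProduct.liftAddHom
    (AddMonoidHom.mk' (fun m => (AddMonoidHom.mulLeft (g m)).comp (structMap S).toAddMonoidHom)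
      (fun m m' => by ext; simp [add_mul]))
    (fun z m r => by simp [mul_assoc, (Int.cast_commute z (g m)).left_comm])

theorem freeBimodLift_tmul {S : RAlg R} (g : M →ₗ[R] S.right) (m : M) (r : R) :
    freeBimodLift g (m ⊗ₜ[ℤ] r) = g m * structMap S r := rfl

theorem freeBimodLift_left {S : RAlg R} (g : M →ₗ[R] S.right) (r : R) (b : M ⊗[ℤ] R) :
    freeBimodLift g (r • b) = structMap S r * freeBimodLift g b := by
  induction b with
  | zero => simp
  | tmul m t =>
    rw [TensorProduct.smul_tmul', freeBimodLift_tmul, freeBimodLift_tmul, map_smul,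
      smul_left_def, mul_assoc]
  | add a b ha hb => rw [smul_add, map_add, map_add, mul_add, ha, hb]

theorem freeBimodLift_right {S : RAlg R} (g : M →ₗ[R] S.right) (r : R) (b : M ⊗[ℤ] R) :
    freeBimodLift g (TensorProduct.map (LinearMap.id : M →ₗ[ℤ] M)
      (DistribSMul.toLinearMap ℤ R (MulOpposite.op r)) b) = freeBimodLift g b * structMap S r := by
  induction b with
  | zero => simp
  | tmul m t => simp [freeBimodLift_tmul, mul_assoc]
  | add a b ha hb => rw [map_add, map_add, map_add, add_mul, ha, hb]

/-- The morphism of `R`-algebras `R⟨M⟩ → S` induced by a morphism of `R`-modules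
`g : M → S`. -/
def freeAlg.lift {S : RAlg R} (g : M →ₗ[R] S.right) : freeAlg R M ⟶ S :=
  Under.homMk (RingCat.ofHom (TensorRing.lift (B := FreeBimod R M) (structMap S) (freeBimodLift g)
    (freeBimodLift_left g) (freeBimodLift_right g)))
    (by
      ext r
      exact TensorRing.lift_ofBase (B := FreeBimod R M) (structMap S) (freeBimodLift g)
        (freeBimodLift_left g) (freeBimodLift_right g) r)

theorem freeAlg.lift_ι {S : RAlg R} (g : M →ₗ[R] S.right) (m : M) :
    (freeAlg.lift g).right (freeAlg.ι m) = g m := by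
  refine (TensorRing.lift_ofBimod (B := FreeBimod R M) (structMap S) (freeBimodLift g)
    (freeBimodLift_left g) (freeBimodLift_right g) (m ⊗ₜ[ℤ] (1 : R) : M ⊗[ℤ] R)).trans ?_
  refine (freeBimodLift_tmul g m 1).trans ?_
  rw [map_one, mul_one]

theorem ofBimod_tmul (m : M) (r : R) :
    (TensorRing.ofBimod R (FreeBimod R M) (m ⊗ₜ[ℤ] r : M ⊗[ℤ] R) : (freeAlg R M).right) =
      freeAlg.ι m * structMap (freeAlg R M) r := by
  refine Eq.trans ?_ (TensorRing.ofBimod_right (B := FreeBimod R M) r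
    (m ⊗ₜ[ℤ] (1 : R) : M ⊗[ℤ] R))
  refine congrArg (TensorRing.ofBimod R (FreeBimod R M)) ?_
  change m ⊗ₜ[ℤ] r = m ⊗ₜ[ℤ] ((1 : R) * r)
  rw [one_mul]

/-- Together with `freeAlg.lift_ι`: morphisms of `R`-algebras `R⟨M⟩ → S` correspond
bijectively to morphisms of `R`-modules `M → S`. -/
theorem freeAlg.hom_ext {S : RAlg R} {f g : freeAlg R M ⟶ S}
    (h : ∀ m : M, f.right (freeAlg.ι m) = g.right (freeAlg.ι m)) : f = g := by
  apply Under.UnderMorphism.ext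
  apply RingCat.hom_ext
  refine TensorRing.hom_ext (B := FreeBimod R M) (f := f.right.hom) (g := g.right.hom) ?_ ?_
  · intro r
    exact (right_structMap f r).trans (right_structMap g r).symm
  · have key : ∀ (k : freeAlg R M ⟶ S) (m : M) (r : R),
        k.right (TensorRing.ofBimod R (FreeBimod R M) (m ⊗ₜ[ℤ] r : M ⊗[ℤ] R) :
          (freeAlg R M).right) = k.right (freeAlg.ι m) * structMap S r := by
      intro k m r
      rw [← right_structMap k, ← map_mul]
      exact congrArg k.right (ofBimod_tmul m r)
    have : (f.right.hom.toAddMonoidHom.comp (TensorRing.ofBimod R (FreeBimod R M)) :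
          M ⊗[ℤ] R →+ S.right) =
        g.right.hom.toAddMonoidHom.comp (TensorRing.ofBimod R (FreeBimod R M)) := by
      refine AddMonoidHom.toIntLinearMap_injective (TensorProduct.ext' fun m r => ?_)
      exact (key f m r).trans ((congrArg (· * structMap S r) (h m)).trans (key g m r).symm)
    exact fun b => DFunLike.congr_fun this b

end FreeAlg

/-! ### The extension `𝔽^r` of a functor of right `𝓡`-modules to `R`-modules -/

section Extension

variable (R : Type u) [Ring R] (M : Type u) [AddCommGroup M] [Module R M]

/-- The element `x` of `R⟨M ⊕ R x⟩`, where `M ⊕ R x` is `M × R` and `x` is `(0, 1)`. -/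
def freeX : (freeAlg R (M × R)).right := freeAlg.ι (R := R) (M := M × R) (0, 1)

/-- The morphism `in : R⟨M⟩ → R⟨M ⊕ R x⟩`, `m ↦ m`. -/
def inHom : freeAlg R M ⟶ freeAlg R (M × R) :=
  freeAlg.lift (freeAlg.ι (R := R) (M := M × R) ∘ₗ LinearMap.inl R M R)

/-- The morphism `h_x : R⟨M⟩ → R⟨M ⊕ R x⟩`, `m ↦ m · x`. -/
def hxHom : freeAlg R M ⟶ freeAlg R (M × R) :=
  freeAlg.lift (rmul (freeAlg R (M × R)) (MulOpposite.op (freeX R M)) ∘ₗ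
    freeAlg.ι (R := R) (M := M × R) ∘ₗ LinearMap.inl R M R)

variable {R}

/-- `𝔽^r(M)`: the kernel of `f ↦ 𝔽(h_x)(f) - 𝔽(in)(f) · x`, a subgroup of `𝔽(R⟨M⟩)`. -/
def RightFunctor.extend (F : RightFunctor.{u, w} R) : AddSubgroup (F.fn.obj (freeAlg R M)) :=
  ((F.fn.map (hxHom R M)).hom -
    (DistribSMul.toAddMonoidHom (F.fn.obj (freeAlg R (M × R))) (MulOpposite.op (freeX R M))).comp
      (F.fn.map (inHom R M)).hom).ker

theorem RightFunctor.mem_extend (F : RightFunctor.{u, w} R) (f : F.fn.obj (freeAlg R M)) :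
    f ∈ F.extend M ↔
      F.fn.map (hxHom R M) f = MulOpposite.op (freeX R M) • F.fn.map (inHom R M) f :=
  sub_eq_zero

end Extension

/-! ### The kernel of `p₁ - p₂` -/

section Kernel

variable (R : Type u) [Ring R] (N : Type u) [AddCommGroup N] [Module Rᵐᵒᵖ N]
  (M : Type u) [AddCommGroup M] [Module R M]

/-- `p₁(n ⊗ m ⊗ r) = n ⊗ m ⊗ r ⊗ 1`. -/
def p₁ : BTensor R N M ⊗[ℤ] R →ₗ[ℤ] (BTensor R N M ⊗[ℤ] R) ⊗[ℤ] R :=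
  (TensorProduct.mk ℤ (BTensor R N M ⊗[ℤ] R) R).flip 1

/-- `p₂(n ⊗ m ⊗ r) = n ⊗ m ⊗ 1 ⊗ r`. -/
def p₂ : BTensor R N M ⊗[ℤ] R →ₗ[ℤ] (BTensor R N M ⊗[ℤ] R) ⊗[ℤ] R :=
  TensorProduct.map ((TensorProduct.mk ℤ (BTensor R N M) R).flip 1) LinearMap.id

theorem p₁_tmul (t : BTensor R N M) (r : R) :
    p₁ R N M (t ⊗ₜ[ℤ] r) = (t ⊗ₜ[ℤ] r) ⊗ₜ[ℤ] 1 := rfl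

theorem p₂_tmul (t : BTensor R N M) (r : R) :
    p₂ R N M (t ⊗ₜ[ℤ] r) = (t ⊗ₜ[ℤ] 1) ⊗ₜ[ℤ] r := rfl

/-- The map `N ⊗_R M ⊗_ℤ R → N ⊗_R R⟨M⟩`, `n ⊗ m ⊗ r ↦ n ⊗ (m · r)`. -/
def toFree : BTensor R N M ⊗[ℤ] R →+ (quasiCoherentRight R N).fn.obj (freeAlg R M) :=
  TensorProduct.liftAddHom (P := BTensor R N (freeAlg R M).right)
    (AddMonoidHom.mk'
      (fun t => AddMonoidHom.mk'
        (fun r => MulOpposite.op (structMap (freeAlg R M) r) •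
          BTensor.map (LinearMap.id : N →ₗ[Rᵐᵒᵖ] N) freeAlg.ι t)
        (fun r s => by rw [map_add, MulOpposite.op_add, add_smul]))
      (fun t t' => by ext r; simp))
    (fun z t r => by simp [mul_smul, Int.cast_smul_eq_zsmul])

theorem toFree_tmul (n : N) (m : M) (r : R) :
    toFree R N M (btmul R n m ⊗ₜ[ℤ] r) =
      (btmul R n (freeAlg.ι m * structMap (freeAlg R M) r) :
        BTensor R N (freeAlg R M).right) := rfl

end Kernel

end FunctorModules

end

/-! An element of `𝓜^∨(S)` is determined by its value on the initial `R`-algebra `R`, so `𝓜^∨(S) =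
Hom_R(M, S)` (`dualPoint_dualLin`, `dualLin_dualPoint`). As a functor of sets this is represented by
`R⟨M⟩` with universal element `i_M`, and Yoneda turns a natural family `𝓜^∨ → 𝓝` into an element `f`
of `𝓝(R⟨M⟩)`. It remains to see which `f` give additive and right linear families.

Right linearity is the equation defining `𝓝^r(M)`: a pair `(g, s)` with `g : M → S` linear and `s ∈
S` is a morphism `R⟨M ⊕ Rx⟩ → S`, and composing it with `in` and `h_x` gives `g` and `g · s`
(`map_lift_smul`).

Additivity is then automatic, because the equation forces `f` into degree one
(`toFree_degOne_of_mem_extend`). Specialize `x` to the central square-zero element `ε` of `R⟨M⟩[ε]`.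
Then `h_x` becomes `m ↦ m ε`, which kills products of two or more elements of `M`, so the
`ε`-coefficient of `𝓝(h_x)(f)` is the degree-one part of `f`; the `ε`-coefficient of `𝓝(in)(f) · ε`
is `f` itself. A degree-one element, a sum of terms `n ⊗ m r`, is sent by `g` to the sum of the
terms `n ⊗ g(m) r`, which is additive in `g`.

For the kernel, `toFree` identifies `N ⊗_R M ⊗_ℤ R` with the degree-one part. On a degree-one
element the two sides of the equation consist of terms `n ⊗ m x r` and `n ⊗ m r x`. Since `n ⊗ m ⊗ r
⊗ s ↦ n ⊗ m r x s` is injective (`toFreeX_injective`), they agree exactly when `p₁ = p₂` on it. -/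

namespace FunctorModules

/-! ### Maps out of `N ⊗_R M`, and associativity with `⊗_ℤ`. -/

section BTensorLift

variable {R : Type*} [Ring R]
variable {N : Type*} [AddCommGroup N] [Module Rᵐᵒᵖ N]
variable {M : Type*} [AddCommGroup M] [Module R M]

/-- The universal property of `N ⊗_R M` for balanced biadditive maps. -/
def BTensor.lift {P : Type*} [AddCommGroup P] (f : N →+ M →+ P)
    (hf : ∀ n (r : R) m, f (MulOpposite.op r • n) m = f n (r • m)) : BTensor R N M →+ P :=
  QuotientAddGroup.lift (balancing R N M)
    (TensorProduct.liftAddHom f fun z n m => by simp)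
    ((AddSubgroup.closure_le _).2 (by
      rintro _ ⟨n, r, m, rfl⟩
      simp [hf]))

@[simp] theorem BTensor.lift_btmul {P : Type*} [AddCommGroup P] (f : N →+ M →+ P)
    (hf : ∀ n (r : R) m, f (MulOpposite.op r • n) m = f n (r • m)) (n : N) (m : M) :
    BTensor.lift f hf (btmul R n m) = f n m := rfl

/-- `m ↦ n ⊗ m`, additively in `n`. -/
def btmulHom : N →+ M →+ BTensor R N M :=
  AddMonoidHom.mk' (fun n => AddMonoidHom.mk' (btmul R n) (btmul_add_right n))
    fun n n' => by ext m; exact btmul_add_left n n' m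

/-- The associativity map `N ⊗_R (M ⊗_ℤ A) → (N ⊗_R M) ⊗_ℤ A`. -/
def BTensor.assoc (A : Type*) [AddCommGroup A] :
    BTensor R N (M ⊗[ℤ] A) →+ BTensor R N M ⊗[ℤ] A :=
  BTensor.lift
    (AddMonoidHom.mk' (fun n => (TensorProduct.map (btmulHom (R := R) n).toIntLinearMap
        (LinearMap.id : A →ₗ[ℤ] A)).toAddMonoidHom)
      (fun n n' => by
        refine AddMonoidHom.toIntLinearMap_injective (TensorProduct.ext' fun m a => ?_)
        exact (congrArg (· ⊗ₜ[ℤ] a) (btmul_add_left n n' m)).trans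
          (TensorProduct.add_tmul _ _ a)))
    (fun n r t => by
      induction t with
      | zero => simp
      | tmul m a =>
        rw [TensorProduct.smul_tmul']
        exact congrArg (· ⊗ₜ[ℤ] a) (btmul_balanced n r m)
      | add a b ha hb => rw [smul_add, map_add, map_add, ha, hb])

/-- Additive maps out of `(N ⊗_R M) ⊗_ℤ A` are determined by the elements `n ⊗ m ⊗ a`. -/
theorem BTensor.tensor_addHom_ext {A P : Type*} [AddCommGroup A] [AddCommGroup P]
    {f g : BTensor R N M ⊗[ℤ] A →+ P}
    (h : ∀ n m a, f (btmul R n m ⊗ₜ[ℤ] a) = g (btmul R n m ⊗ₜ[ℤ] a)) : f = g := by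
  refine AddMonoidHom.toIntLinearMap_injective (TensorProduct.ext' fun t a => ?_)
  have := BTensor.addHom_ext (R := R)
    (f := f.comp ((TensorProduct.mk ℤ (BTensor R N M) A).flip a).toAddMonoidHom)
    (g := g.comp ((TensorProduct.mk ℤ (BTensor R N M) A).flip a).toAddMonoidHom)
    fun n m => h n m a
  exact DFunLike.congr_fun this t

/-- Additive maps out of `N ⊗_R (M ⊗_ℤ A)` are determined by the elements `n ⊗ (m ⊗ a)`. -/
theorem BTensor.addHom_ext_tensor {A P : Type*} [AddCommGroup A] [AddCommGroup P]
    {f g : BTensor R N (M ⊗[ℤ] A) →+ P}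
    (h : ∀ n m a, f (btmul R n (m ⊗ₜ[ℤ] a)) = g (btmul R n (m ⊗ₜ[ℤ] a))) : f = g := by
  refine BTensor.addHom_ext fun n t => ?_
  have : (f.comp (btmulHom n)).toIntLinearMap = (g.comp (btmulHom n)).toIntLinearMap :=
    TensorProduct.ext' fun m a => h n m a
  exact DFunLike.congr_fun this t

end BTensorLift

/-! ### The identification `𝓜^∨(S) = Hom_R(M, S)`. -/

section DualPoint

variable {R : Type u} [Ring R] {M : Type u} [AddCommGroup M] [Module R M]

variable (R) in
/-- `R` as an `R`-algebra. -/
def baseAlg : RAlg R := Under.mk (𝟙 (RingCat.of R))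

/-- The structure morphism `R → S` as a morphism of `R`-algebras. -/
def baseHom (S : RAlg R) : baseAlg R ⟶ S := Under.homMk S.hom (Category.id_comp _)

variable (R) in
/-- The identity `R → R`, from `R` as an `R`-algebra. -/
def baseVal : (baseAlg R).right →+* R := RingHom.id R

/-- The map `R ⊗_R L → L`. -/
def BTensor.baseMul (L : Type u) [AddCommGroup L] [Module R L] :
    BTensor R (baseAlg R).right L →+ L :=
  BTensor.lift (AddMonoidHom.mk' (fun r => DistribSMul.toAddMonoidHom L (baseVal R r))
      (fun r s => by ext m; simp [add_smul]))
    (fun n r m => mul_smul (baseVal R n) r m)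

theorem BTensor.btmul_baseMul {L : Type u} [AddCommGroup L] [Module R L]
    (y : BTensor R (baseAlg R).right L) :
    btmul R (1 : (baseAlg R).right) (BTensor.baseMul L y) = y := by
  have := BTensor.addHom_ext (R := R)
    (f := (btmulHom (R := R) (1 : (baseAlg R).right)).comp (BTensor.baseMul L))
    (g := AddMonoidHom.id (BTensor R (baseAlg R).right L)) fun r l => by
      refine (btmul_balanced (1 : (baseAlg R).right) (baseVal R r) l).symm.trans ?_
      exact congrArg (btmul R · l) (one_mul r)
  exact DFunLike.congr_fun this y

theorem BTensor.baseMul_smul {L : Type u} [AddCommGroup L] [Module R L] (r : R)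
    (y : BTensor R (baseAlg R).right L) :
    BTensor.baseMul L (structMap (baseAlg R) r • y) = r • BTensor.baseMul L y := by
  have := BTensor.addHom_ext (R := R)
    (f := (BTensor.baseMul L).comp (DistribSMul.toAddMonoidHom
      (BTensor R (baseAlg R).right L) (structMap (baseAlg R) r)))
    (g := (DistribSMul.toAddMonoidHom L r).comp (BTensor.baseMul L))
    fun n l => mul_smul r (baseVal R n) l
  exact DFunLike.congr_fun this y

theorem btmul_one_smul (S : RAlg R) (r : R) (m : M) :
    btmul R (1 : S.right) (r • m) = structMap S r • btmul R (1 : S.right) m := by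
  rw [← btmul_balanced, smul_right_def, one_mul]
  exact congrArg (btmul R · m) (mul_one _).symm

variable {S : RAlg R}

/-- The morphism of `R`-modules `M → S` given by an element of `𝓜^∨(S)`. -/
def dualLin (ψ : (quasiCoherent R M).hom (quasiCoherent R S.right)) : M →ₗ[R] S.right where
  toFun m := BTensor.baseMul S.right (ψ.1 (baseAlg R) (btmul R (1 : (baseAlg R).right) m))
  map_add' m m' := (congrArg (fun y => BTensor.baseMul S.right (ψ.1 (baseAlg R) y))
    (btmul_add_right _ m m')).trans
      ((congrArg (BTensor.baseMul S.right) (map_add (ψ.1 (baseAlg R)) _ _)).trans (map_add _ _ _))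
  map_smul' r m := (congrArg (fun y => BTensor.baseMul S.right (ψ.1 (baseAlg R) y))
    (btmul_one_smul (baseAlg R) r m)).trans
      ((congrArg (BTensor.baseMul S.right) (ψ.2.1 (baseAlg R) _ _)).trans
        (BTensor.baseMul_smul r _))

/-- Since `t ⊗ m = t (1 ⊗ m)` and `1 ⊗ m` comes from the initial algebra `R`, linearity and
naturality determine `ψ` by its component at `R`, where `R ⊗_R S = S`. -/
theorem dualPoint_dualLin (ψ : (quasiCoherent R M).hom (quasiCoherent R S.right)) :
    dualPoint (dualLin ψ) = ψ := by
  apply Subtype.ext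
  funext T
  refine BTensor.addHom_ext fun t m => ?_
  have h₁ : btmul R t m = t • btmul R (1 : T.right) m :=
    congrArg (btmul R · m) (mul_one t).symm
  have h₂ : btmul R (1 : T.right) m =
      (quasiCoherent R M).fn.map (baseHom T) (btmul R (1 : (baseAlg R).right) m) :=
    congrArg (btmul R · m) (map_one (baseHom T).right.hom).symm
  have h₃ : ψ.1 T (btmul R (1 : T.right) m) = btmul R (1 : T.right) (dualLin ψ m) := by
    rw [h₂]
    refine (ψ.2.2 _ _ (baseHom T) _).trans ?_
    refine (congrArg ((quasiCoherent R S.right).fn.map (baseHom T))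
      (BTensor.btmul_baseMul _).symm).trans ?_
    exact congrArg (btmul R · (dualLin ψ m)) (map_one (baseHom T).right.hom)
  refine Eq.symm ?_
  refine (congrArg (ψ.1 T) h₁).trans ((ψ.2.1 T t _).trans ?_)
  refine (congrArg (t • ·) h₃).trans ?_
  exact congrArg (btmul R · (dualLin ψ m)) (mul_one t)

theorem dualLin_dualPoint (g : M →ₗ[R] S.right) : dualLin (dualPoint g) = g := by
  ext m
  exact one_smul R (g m)

theorem dualLin_add (ψ ψ' : (quasiCoherent R M).hom (quasiCoherent R S.right)) :
    dualLin (ψ + ψ') = dualLin ψ + dualLin ψ' := by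
  ext m
  exact map_add (BTensor.baseMul S.right) _ _

theorem dual_map_dualPoint {T : RAlg R} (f : S ⟶ T) (g : M →ₗ[R] S.right) :
    (quasiCoherent R M).dual.fn.map f (dualPoint g) = dualPoint (algLeft f ∘ₗ g) := by
  apply Subtype.ext
  funext A
  exact BTensor.addHom_ext fun _ _ => rfl

theorem op_smul_dualPoint (s : S.right) (g : M →ₗ[R] S.right) :
    MulOpposite.op s • dualPoint g = dualPoint (rmul S (MulOpposite.op s) ∘ₗ g) := by
  apply Subtype.ext
  funext A
  exact BTensor.addHom_ext fun _ _ => rfl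

theorem algLeft_lift_comp_ι (g : M →ₗ[R] S.right) : algLeft (freeAlg.lift g) ∘ₗ freeAlg.ι = g :=
  LinearMap.ext (freeAlg.lift_ι g)

end DualPoint

/-! ### Pure tensors in the bimodule `M ⊗_ℤ R`. -/

section FreeBimod

variable {R : Type u} [Ring R] {M : Type u} [AddCommGroup M]

/-- The element `m ⊗ r` of the bimodule `M ⊗_ℤ R`. -/
def FreeBimod.tmul (m : M) (r : R) : FreeBimod R M := (m ⊗ₜ[ℤ] r : M ⊗[ℤ] R)

theorem FreeBimod.induction {p : FreeBimod R M → Prop} (zero : p 0)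
    (tmul : ∀ m r, p (FreeBimod.tmul m r)) (add : ∀ a b, p a → p b → p (a + b))
    (b : FreeBimod R M) : p b :=
  TensorProduct.induction_on b zero tmul add

theorem FreeBimod.tmul_add (m m' : M) (r : R) :
    FreeBimod.tmul (m + m') r = FreeBimod.tmul m r + FreeBimod.tmul m' r :=
  TensorProduct.add_tmul m m' r

theorem FreeBimod.smul_tmul [Module R M] (r s : R) (m : M) :
    r • FreeBimod.tmul m s = FreeBimod.tmul (r • m) s := rfl

end FreeBimod

/-! ### The degree-one part of `R⟨M⟩`, split off by a square-zero extension. -/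

section Degree

theorem snd_inl_mul {A B : Type*} [Ring A] [AddCommGroup B] [Module A B] [Module Aᵐᵒᵖ B]
    (a : A) (y : TrivSqZeroExt A B) : (TrivSqZeroExt.inl a * y).snd = a • y.snd := by
  simp

variable (R : Type u) [Ring R] (M : Type u) [AddCommGroup M] [Module R M]

/-- The compatibility of the two actions makes the square-zero extension of `R` by `M ⊗_ℤ R` a ring,
and later makes `stepEnd` left linear. -/
instance : SMulCommClass R Rᵐᵒᵖ (FreeBimod R M) where
  smul_comm r s b := by
    induction b using FreeBimod.induction with
    | zero => simp only [smul_zero]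
    | tmul m t => rfl
    | add a b ha hb => simp only [smul_add, ha, hb]

instance : SMulCommClass Rᵐᵒᵖ R (FreeBimod R M) := SMulCommClass.symm R Rᵐᵒᵖ _

/-- The square-zero extension of `R` by the bimodule `M ⊗_ℤ R`. -/
def sqZeroAlg : RAlg R :=
  Under.mk (RingCat.ofHom (TrivSqZeroExt.inlHom R (FreeBimod R M)))

/-- The truncation `R⟨M⟩ → R ⊕ (M ⊗_ℤ R)` in degrees at most one. -/
def truncHom : freeAlg R M ⟶ sqZeroAlg R M :=
  freeAlg.lift (S := sqZeroAlg R M)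
    { toFun := fun m => (TrivSqZeroExt.inr (FreeBimod.tmul m 1) :
        TrivSqZeroExt R (FreeBimod R M))
      map_add' := fun m m' => (congrArg TrivSqZeroExt.inr
        (TensorProduct.add_tmul m m' (1 : R))).trans (TrivSqZeroExt.inr_add R _ _)
      map_smul' := fun r m =>
        (TrivSqZeroExt.inl_mul_inr r (FreeBimod.tmul m (1 : R))).symm }

/-- The projection of `R⟨M⟩` onto its degree-one part `M ⊗_ℤ R`. -/
def degOne : (freeAlg R M).right →ₗ[R] M ⊗[ℤ] R where
  toFun y := TrivSqZeroExt.snd (R := R) (M := FreeBimod R M) ((truncHom R M).right y)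
  map_add' y z := by
    rw [map_add]
    exact TrivSqZeroExt.snd_add _ _
  map_smul' r y := by
    rw [smul_left_def, map_mul, right_structMap]
    exact snd_inl_mul (A := R) (B := FreeBimod R M) r _

/-- The inclusion of the degree-one part `M ⊗_ℤ R` in `R⟨M⟩`. -/
def ofDegOne : M ⊗[ℤ] R →ₗ[R] (freeAlg R M).right where
  toFun := TensorRing.ofBimod R (FreeBimod R M)
  map_add' := map_add (TensorRing.ofBimod R (FreeBimod R M))
  map_smul' := TensorRing.ofBimod_left (B := FreeBimod R M)

variable {R M}

theorem degOne_ι_mul (m : M) (r : R) :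
    degOne R M (freeAlg.ι m * structMap (freeAlg R M) r) = m ⊗ₜ[ℤ] r := by
  change TrivSqZeroExt.snd (R := R) (M := FreeBimod R M)
    ((truncHom R M).right (freeAlg.ι m * structMap (freeAlg R M) r)) = _
  rw [map_mul, right_structMap, truncHom, freeAlg.lift_ι]
  refine (congrArg TrivSqZeroExt.snd (TrivSqZeroExt.inr_mul_inl (R := R) (M := FreeBimod R M) r
    (FreeBimod.tmul m 1))).trans ?_
  exact congrArg (m ⊗ₜ[ℤ] ·) (one_mul r)

variable (R M)
variable (N : Type u) [AddCommGroup N] [Module Rᵐᵒᵖ N]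

/-- The degree-one projection is left `R`-linear, hence survives `N ⊗_R -` and splits `toFree`; no
flatness of `N` is needed. -/
theorem toFree_leftInverse : Function.LeftInverse
    (fun f : BTensor R N (freeAlg R M).right =>
      BTensor.assoc R (BTensor.map LinearMap.id (degOne R M) f)) (toFree R N M) := by
  intro z
  have := BTensor.tensor_addHom_ext (R := R)
    (f := ((BTensor.assoc R).comp (BTensor.map LinearMap.id (degOne R M))).comp (toFree R N M))
    (g := AddMonoidHom.id _) fun n m r => by
      exact congrArg (fun b => BTensor.assoc R (btmul R n b)) (degOne_ι_mul m r)
  exact DFunLike.congr_fun this z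

/-- With this, `toFree` of the degree-one component of `f` is `id ⊗ (ofDegOne ∘ degOne)` applied to
`f`, which reduces comparisons to maps of left `R`-modules on `R⟨M⟩`. -/
theorem toFree_assoc (y : BTensor R N (M ⊗[ℤ] R)) :
    toFree R N M (BTensor.assoc R y) = BTensor.map LinearMap.id (ofDegOne R M) y := by
  have := BTensor.addHom_ext_tensor (R := R) (f := (toFree R N M).comp (BTensor.assoc R))
    (g := BTensor.map LinearMap.id (ofDegOne R M))
    fun n m r => congrArg (btmul R n) (ofBimod_tmul m r).symm
  exact DFunLike.congr_fun this y

end Degree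

/-! ### Elements of `𝓝^r(M)` have degree one: the specialization `x ↦ ε`. -/

section DualNumbers

variable {R : Type u} [Ring R]

/-- The dual numbers `A[ε]` over an `R`-algebra `A`. -/
def dualNumAlg (A : RAlg R) : RAlg R :=
  Under.mk (RingCat.ofHom ((TrivSqZeroExt.inlHom A.right A.right).comp (structMap A)))

/-- The inclusion `A → A[ε]`. -/
def dualNumInl (A : RAlg R) : A ⟶ dualNumAlg A :=
  Under.homMk (RingCat.ofHom (TrivSqZeroExt.inlHom A.right A.right)) rfl

/-- The coefficient of `ε`. -/
def dualNumSnd (A : RAlg R) : (dualNumAlg A).right →ₗ[R] A.right where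
  toFun y := TrivSqZeroExt.snd (R := A.right) (M := A.right) y
  map_add' _ _ := rfl
  map_smul' r y := snd_inl_mul (A := A.right) (B := A.right) (structMap A r) y

variable (M : Type u) [AddCommGroup M] [Module R M]

/-- The morphism `R⟨M ⊕ R x⟩ → R⟨M⟩[ε]`, `m ↦ m`, `x ↦ ε`. -/
def specializeEps : freeAlg R (M × R) ⟶ dualNumAlg (freeAlg R M) :=
  freeAlg.lift (LinearMap.coprod (algLeft (dualNumInl (freeAlg R M)) ∘ₗ freeAlg.ι)
    (LinearMap.toSpanSingleton R (dualNumAlg (freeAlg R M)).right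
      (DualNumber.eps : DualNumber (freeAlg R M).right)))

theorem specializeEps_x : (specializeEps M).right (freeX R M) =
    (DualNumber.eps : DualNumber (freeAlg R M).right) := by
  refine (freeAlg.lift_ι _ ((0, 1) : M × R)).trans ?_
  refine (LinearMap.coprod_apply ..).trans ?_
  rw [map_zero, zero_add]
  exact one_smul R _

theorem specializeEps_ι (m : M) : (specializeEps M).right
    (freeAlg.ι (R := R) (M := M × R) (m, 0)) =
      (dualNumInl (freeAlg R M)).right (freeAlg.ι m) := by
  refine (freeAlg.lift_ι _ ((m, 0) : M × R)).trans ?_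
  refine (LinearMap.coprod_apply ..).trans ?_
  rw [map_zero, add_zero]
  rfl

theorem inHom_ι (m : M) : (inHom R M).right (freeAlg.ι m) =
    freeAlg.ι (R := R) (M := M × R) (m, 0) := freeAlg.lift_ι _ m

theorem hxHom_ι (m : M) : (hxHom R M).right (freeAlg.ι m) =
    freeAlg.ι (R := R) (M := M × R) (m, 0) * freeX R M := freeAlg.lift_ι _ m

theorem inHom_specializeEps : inHom R M ≫ specializeEps M = dualNumInl (freeAlg R M) := by
  refine freeAlg.hom_ext fun m => ?_
  refine (congrArg (specializeEps M).right (inHom_ι M m)).trans ?_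
  exact specializeEps_ι M m

/-- The morphism `R ⊕ (M ⊗_ℤ R) → R⟨M⟩[ε]`, `(r, b) ↦ r + b ε`. -/
def sqZeroToDualNum : sqZeroAlg R M ⟶ dualNumAlg (freeAlg R M) :=
  Under.homMk (RingCat.ofHom
    { toFun := fun y : TrivSqZeroExt R (FreeBimod R M) =>
        ((structMap (freeAlg R M) y.fst, ofDegOne R M y.snd) : DualNumber (freeAlg R M).right)
      map_one' := Prod.ext (map_one (structMap (freeAlg R M))) (map_zero (ofDegOne R M))
      map_zero' := Prod.ext (map_zero (structMap (freeAlg R M))) (map_zero (ofDegOne R M))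
      map_add' := fun y z => Prod.ext (map_add (structMap (freeAlg R M)) _ _)
        (map_add (ofDegOne R M) _ _)
      -- Products of two degree-one parts vanish on both sides, so only the bimodule linearity of
      -- `ofDegOne` is involved.
      map_mul' := fun y z => Prod.ext (map_mul (structMap (freeAlg R M)) _ _)
        ((map_add (ofDegOne R M) _ _).trans (congrArg₂ (· + ·) (map_smul (ofDegOne R M) _ _)
          (TensorRing.ofBimod_right (B := FreeBimod R M) z.fst y.snd))) })
    (by
      ext r
      exact Prod.ext rfl (map_zero (ofDegOne R M)))

/-- Both sides are `m ↦ m ε`. The factorization through `truncHom` records that longer products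
contain `ε ^ 2 = 0`. -/
theorem hxHom_specializeEps :
    hxHom R M ≫ specializeEps M = truncHom R M ≫ sqZeroToDualNum M := by
  refine freeAlg.hom_ext fun m => ?_
  refine (congrArg (specializeEps M).right (hxHom_ι M m)).trans ?_
  refine Eq.trans ?_ (congrArg (sqZeroToDualNum M).right (freeAlg.lift_ι _ m)).symm
  rw [map_mul, specializeEps_x, specializeEps_ι]
  refine TrivSqZeroExt.ext (R := (freeAlg R M).right) (M := (freeAlg R M).right) ?_ ?_
  · exact (mul_zero (freeAlg.ι (R := R) m)).trans (map_zero (structMap (freeAlg R M))).symm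
  · refine (snd_inl_mul (freeAlg.ι (R := R) m) DualNumber.eps).trans ?_
    exact mul_one _

variable (N : Type u) [AddCommGroup N] [Module Rᵐᵒᵖ N]

/-- Both members of the equation defining `𝓝^r(M)` are specialized at `x = ε`, and their
`ε`-coefficients are compared. -/
theorem toFree_degOne_of_mem_extend {f : (quasiCoherentRight R N).fn.obj (freeAlg R M)}
    (hf : f ∈ (quasiCoherentRight R N).extend M) :
    toFree R N M (BTensor.assoc R (BTensor.map LinearMap.id (degOne R M) f)) = f := by
  rw [RightFunctor.mem_extend] at hf
  have h := congrArg (fun y => BTensor.map (LinearMap.id : N →ₗ[Rᵐᵒᵖ] N)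
    (dualNumSnd (freeAlg R M) ∘ₗ algLeft (specializeEps M)) y) hf
  refine (toFree_assoc R M N _).trans ((BTensor.map_map _ _ _ _ f).trans ?_)
  refine Eq.trans ?_ (h.trans ?_)
  -- The `h_x` side yields the degree-one part of `f`; the degree-zero part has no `ε`-coefficient.
  · refine Eq.trans ?_ (BTensor.map_map LinearMap.id (algLeft (hxHom R M)) LinearMap.id
      (dualNumSnd (freeAlg R M) ∘ₗ algLeft (specializeEps M)) f).symm
    refine BTensor.map_congr (fun _ => rfl) (fun y => ?_) f
    exact congrArg (fun k : freeAlg R M ⟶ dualNumAlg (freeAlg R M) =>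
      dualNumSnd (freeAlg R M) (k.right y)) (hxHom_specializeEps M).symm
  -- The `in` side is `f ε`, whose `ε`-coefficient is all of `f`.
  · refine (congrArg _ (BTensor.map_map LinearMap.id (algLeft (inHom R M)) LinearMap.id
      (rmul (freeAlg R (M × R)) (MulOpposite.op (freeX R M))) f)).trans ?_
    refine (BTensor.map_map _ _ _ _ f).trans ?_
    refine (BTensor.map_congr (f' := LinearMap.id) (g' := LinearMap.id) (fun _ => rfl)
      (fun y => ?_) f).trans (DFunLike.congr_fun BTensor.map_id f)
    change dualNumSnd (freeAlg R M) ((specializeEps M).right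
      ((inHom R M).right y * freeX R M)) = y
    rw [map_mul, specializeEps_x]
    refine (congrArg (fun k : freeAlg R M ⟶ dualNumAlg (freeAlg R M) =>
      dualNumSnd (freeAlg R M) (HMul.hMul (α := DualNumber (freeAlg R M).right) (k.right y)
        DualNumber.eps))
      (inHom_specializeEps M)).trans ?_
    refine (snd_inl_mul y DualNumber.eps).trans ?_
    exact mul_one y

end DualNumbers

/-! ### A right module over `R⟨M ⊕ Rx⟩` that reads off the coefficient of `m r x s`. -/

section Bilinear

variable (R : Type u) [Ring R] (M : Type u) [AddCommGroup M] [Module R M]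

/-- The module `R ⊕ (M ⊗ R) ⊕ (M ⊗ R ⊗ R)` on which `R⟨M ⊕ R x⟩` acts on the right. -/
abbrev StepModule : Type u := R × FreeBimod R M × FreeBimod R (FreeBimod R M)

/-- The `R`-algebra of endomorphisms of `R ⊕ (M ⊗ R) ⊕ (M ⊗ R ⊗ R)`, acting on the right. -/
def stepAlg : RAlg R :=
  Under.mk (RingCat.ofHom ((Module.toModuleEnd R (S := Rᵐᵒᵖ) (StepModule R M)).op.comp
    (RingEquiv.opOp R).toRingHom))

variable {R M}

/-- The right action of an element of `stepAlg R M`. -/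
def stepAct (y : (stepAlg R M).right) : StepModule R M →ₗ[R] StepModule R M :=
  MulOpposite.unop (α := Module.End R (StepModule R M)) y

theorem stepAct_mul (y z : (stepAlg R M).right) (v : StepModule R M) :
    stepAct (y * z) v = stepAct z (stepAct y v) := rfl

theorem stepAct_structMap (r : R) (v : StepModule R M) :
    stepAct (structMap (stepAlg R M) r) v = MulOpposite.op r • v := rfl

theorem stepAct_add (y z : (stepAlg R M).right) (v : StepModule R M) :
    stepAct (y + z) v = stepAct y v + stepAct z v := rfl

/-- The endomorphism `(r, b, c) ↦ (0, r m ⊗ 1, b s ⊗ 1)`. -/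
def stepEnd (p : M × R) : StepModule R M →ₗ[R] StepModule R M where
  toFun v := (0, FreeBimod.tmul (v.1 • p.1) 1, FreeBimod.tmul (MulOpposite.op p.2 • v.2.1) 1)
  map_add' v w := by
    simp only [Prod.fst_add, Prod.snd_add, add_smul, smul_add, FreeBimod.tmul_add, Prod.mk_add_mk,
      add_zero]
  map_smul' r v := by
    simp only [Prod.smul_fst, Prod.smul_snd, smul_eq_mul, mul_smul, smul_comm (MulOpposite.op p.2) r,
      RingHom.id_apply, Prod.smul_mk, mul_zero,
      FreeBimod.smul_tmul]

variable (R M)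

/-- The right action of `R⟨M ⊕ R x⟩` on `R ⊕ (M ⊗ R) ⊕ (M ⊗ R ⊗ R)`. -/
def stepHom : freeAlg R (M × R) ⟶ stepAlg R M :=
  freeAlg.lift (S := stepAlg R M)
    { toFun := fun p => MulOpposite.op (stepEnd p : Module.End R (StepModule R M))
      map_add' := fun p q => by
        refine congrArg MulOpposite.op (LinearMap.ext fun v => ?_ :
          (stepEnd (p + q) : Module.End R (StepModule R M)) = stepEnd p + stepEnd q)
        simp [stepEnd, add_smul, FreeBimod.tmul_add]
      map_smul' := fun r p => by
        refine congrArg MulOpposite.op (LinearMap.ext fun v => ?_ :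
          (stepEnd (r • p) : Module.End R (StepModule R M)) =
            stepEnd p * Module.toModuleEnd R (S := Rᵐᵒᵖ) (StepModule R M) (MulOpposite.op r))
        simp [stepEnd, mul_smul] }

/-- The left `R`-linear map `R⟨M ⊕ R x⟩ → (M ⊗ R) ⊗ R` sending `m r x s` to `m ⊗ r ⊗ s`. -/
def stepCoeff : (freeAlg R (M × R)).right →ₗ[R] (M ⊗[ℤ] R) ⊗[ℤ] R where
  toFun y := (stepAct ((stepHom R M).right y) (1, 0, 0)).2.2
  map_add' y z := by
    rw [map_add, stepAct_add]
    rfl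
  map_smul' r y := by
    rw [smul_left_def, map_mul, right_structMap, stepAct_mul, stepAct_structMap]
    -- Left and right scalars agree on the starting vector, so `r` can be moved to the left, where
    -- every `stepAct` is linear.
    have : (MulOpposite.op r • ((1, 0, 0) : StepModule R M)) = r • (1, 0, 0) := by
      simp
    rw [this, map_smul]
    rfl

variable {R M}

/-- Only the last two components are nonzero in turn: `(1, 0, 0)` goes under `m` and `r` to `m ⊗ r`
in the middle component, then under `x` and `s` to `(m ⊗ r) ⊗ s` in the last. -/
theorem stepCoeff_monomial (m : M) (r s : R) :
    stepCoeff R M (freeAlg.ι (R := R) (M := M × R) (m, 0) * structMap (freeAlg R (M × R)) r *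
      freeX R M * structMap (freeAlg R (M × R)) s) = (m ⊗ₜ[ℤ] r) ⊗ₜ[ℤ] s := by
  have hι : ∀ p v, stepAct ((stepHom R M).right (freeAlg.ι (R := R) (M := M × R) p)) v =
      stepEnd p v := fun p v => congrArg (stepAct · v) (freeAlg.lift_ι _ p)
  change (stepAct ((stepHom R M).right (_ * _ * _ * _)) (1, 0, 0)).2.2 = _
  rw [map_mul, map_mul, map_mul, right_structMap, right_structMap, stepAct_mul, stepAct_mul,
    stepAct_mul, hι, freeX, hι, stepAct_structMap, stepAct_structMap]
  change FreeBimod.tmul (MulOpposite.op (1 : R) • FreeBimod.tmul ((1 : R) • m) (1 * r)) (1 * s) = _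
  rw [one_smul, one_mul, one_mul, MulOpposite.op_one, one_smul]
  rfl

end Bilinear

/-! ### Extending a map of groups by the right action of `R`. -/

section RightAct

variable {R : Type u} [Ring R] {S : RAlg R} {P : Type*} [AddCommGroup P] [Module S.rightᵐᵒᵖ P]

/-- The map `L ⊗_ℤ R → P`, `l ⊗ r ↦ h(l) r`, for a morphism of groups `h` from `L` to a right
`S`-module `P`. -/
def rightActHom {L : Type*} [AddCommGroup L] (h : L →+ P) : L ⊗[ℤ] R →+ P :=
  TensorProduct.liftAddHom
    (AddMonoidHom.mk'
      (fun t => AddMonoidHom.mk' (fun r => MulOpposite.op (structMap S r) • h t)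
        (fun r s => by rw [map_add, MulOpposite.op_add, add_smul]))
      (fun t t' => by ext r; simp))
    (fun z t r => by simp [mul_smul, Int.cast_smul_eq_zsmul])

theorem rightActHom_add {L : Type*} [AddCommGroup L] (h h' : L →+ P) :
    rightActHom (S := S) (h + h') = rightActHom (S := S) h + rightActHom (S := S) h' := by
  refine AddMonoidHom.toIntLinearMap_injective (TensorProduct.ext' fun l r => ?_)
  exact smul_add _ _ _

end RightAct

/-! ### The isomorphism between the kernel of `p₁ - p₂` and `𝓝^r(M)`. -/

section Kernel

variable {R : Type u} [Ring R] (M : Type u) [AddCommGroup M] [Module R M]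
  (N : Type u) [AddCommGroup N] [Module Rᵐᵒᵖ N]

/-- The map `N ⊗_R M ⊗_ℤ R ⊗_ℤ R → N ⊗_R R⟨M ⊕ R x⟩`, `n ⊗ m ⊗ r ⊗ s ↦ n ⊗ (m r x s)`. -/
def toFreeX : (BTensor R N M ⊗[ℤ] R) ⊗[ℤ] R →+ BTensor R N (freeAlg R (M × R)).right :=
  rightActHom (S := freeAlg R (M × R)) ((DistribSMul.toAddMonoidHom
      (BTensor R N (freeAlg R (M × R)).right) (MulOpposite.op (freeX R M))).comp
    (rightActHom (S := freeAlg R (M × R)) (BTensor.map (LinearMap.id : N →ₗ[Rᵐᵒᵖ] N)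
      (freeAlg.ι (R := R) (M := M × R) ∘ₗ LinearMap.inl R M R))))

/-- The retraction is `id ⊗ stepCoeff` followed by two rebracketings; left linearity of `stepCoeff`
is what allows tensoring it with `N`. -/
theorem toFreeX_injective : Function.Injective (toFreeX (R := R) M N) := by
  let ρ : BTensor R N (freeAlg R (M × R)).right →+ (BTensor R N M ⊗[ℤ] R) ⊗[ℤ] R :=
    ((TensorProduct.map (BTensor.assoc (R := R) (N := N) (M := M) R).toIntLinearMap
      (LinearMap.id : R →ₗ[ℤ] R)).toAddMonoidHom.comp (BTensor.assoc R)).comp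
        (BTensor.map LinearMap.id (stepCoeff R M))
  refine Function.LeftInverse.injective (g := ρ) fun z => ?_
  have : (ρ.comp (toFreeX M N)).toIntLinearMap = LinearMap.id := by
    refine TensorProduct.ext' fun y s => ?_
    have := BTensor.tensor_addHom_ext (R := R)
      (f := (ρ.comp (toFreeX M N)).comp
        ((TensorProduct.mk ℤ (BTensor R N M ⊗[ℤ] R) R).flip s).toAddMonoidHom)
      (g := ((TensorProduct.mk ℤ (BTensor R N M ⊗[ℤ] R) R).flip s).toAddMonoidHom)
      fun n m r => congrArg (fun b => TensorProduct.map
        (BTensor.assoc (R := R) (N := N) (M := M) R).toIntLinearMap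
        (LinearMap.id : R →ₗ[ℤ] R) (BTensor.assoc R (btmul R n b))) (stepCoeff_monomial m r s)
    exact DFunLike.congr_fun this y
  exact DFunLike.congr_fun this z

/-- `h_x` turns `m r` into `m x r = m 1 x r`: the slot before `x` receives `1`. -/
theorem map_hxHom_toFree (z : BTensor R N M ⊗[ℤ] R) :
    (quasiCoherentRight R N).fn.map (hxHom R M) (toFree R N M z) =
      toFreeX M N (p₂ R N M z) := by
  have := BTensor.tensor_addHom_ext (R := R)
    (f := (BTensor.map LinearMap.id (algLeft (hxHom R M))).comp (toFree R N M))
    (g := (toFreeX M N).comp (p₂ R N M).toAddMonoidHom) fun n m r => by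
      refine congrArg (btmul R n) (?_ : (hxHom R M).right (freeAlg.ι m * structMap _ r) =
        freeAlg.ι (R := R) (M := M × R) (m, 0) * structMap (freeAlg R (M × R)) 1 *
          freeX R M * structMap (freeAlg R (M × R)) r)
      rw [map_mul, hxHom_ι, right_structMap, map_one, mul_one]
  exact DFunLike.congr_fun this z

/-- Here `m r` becomes `m r x = m r x 1`: the slot after `x` receives `1`. -/
theorem op_freeX_smul_map_inHom_toFree (z : BTensor R N M ⊗[ℤ] R) :
    MulOpposite.op (freeX R M) •
        (quasiCoherentRight R N).fn.map (inHom R M) (toFree R N M z) =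
      toFreeX M N (p₁ R N M z) := by
  have := BTensor.tensor_addHom_ext (R := R)
    (f := (BTensor.map LinearMap.id (rmul _ (MulOpposite.op (freeX R M)))).comp
      ((BTensor.map LinearMap.id (algLeft (inHom R M))).comp (toFree R N M)))
    (g := (toFreeX M N).comp (p₁ R N M).toAddMonoidHom) fun n m r => by
      refine congrArg (btmul R n)
        (?_ : (inHom R M).right (freeAlg.ι m * structMap _ r) * freeX R M =
          freeAlg.ι (R := R) (M := M × R) (m, 0) * structMap (freeAlg R (M × R)) r *
            freeX R M * structMap (freeAlg R (M × R)) 1)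
      rw [map_mul, inHom_ι, right_structMap, map_one, mul_one]
  exact DFunLike.congr_fun this z

theorem toFree_mem_extend_iff (z : BTensor R N M ⊗[ℤ] R) :
    toFree R N M z ∈ (quasiCoherentRight R N).extend M ↔
      z ∈ LinearMap.ker (p₁ R N M - p₂ R N M) := by
  rw [RightFunctor.mem_extend, map_hxHom_toFree, op_freeX_smul_map_inHom_toFree,
    LinearMap.mem_ker, LinearMap.sub_apply, sub_eq_zero]
  exact ⟨fun h => (toFreeX_injective M N h).symm, fun h => congrArg _ h.symm⟩

/-- The isomorphism `Ker(p₁ - p₂) ≃ 𝓝^r(M)`. -/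
noncomputable def kerEquivExtend : LinearMap.ker (p₁ R N M - p₂ R N M) ≃+ (quasiCoherentRight R N).extend M :=
  AddEquiv.ofBijective
    (AddMonoidHom.mk' (fun z => ⟨toFree R N M z.1, (toFree_mem_extend_iff M N z.1).2 z.2⟩)
      fun z z' => Subtype.ext (map_add (toFree R N M) z.1 z'.1))
    ⟨fun z z' h => Subtype.ext ((toFree_leftInverse R M N).injective (congrArg Subtype.val h)),
      -- The preimage is the degree-one component of `f`; it lies in the kernel because its image is
      -- `f` again.
      fun f => ⟨⟨_, (toFree_mem_extend_iff M N _).1 (by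
          have := toFree_degOne_of_mem_extend M N f.2
          exact this.symm ▸ f.2)⟩, Subtype.ext (toFree_degOne_of_mem_extend M N f.2)⟩⟩

end Kernel

/-! ### Yoneda for `𝓜^∨`, represented by `R⟨M⟩`. -/

section Yoneda

variable {R : Type u} [Ring R] (M : Type u) [AddCommGroup M] [Module R M]

/-- Every `ψ` is the image of the universal point `i_M` under the algebra morphism `R⟨M⟩ → S` that
it induces, so naturality determines `φ`. -/
theorem dual_apply_eq {F : RightFunctor.{u, w} R} (φ : (quasiCoherent R M).dual.hom F)
    {S : RAlg R} (ψ : (quasiCoherent R M).hom (quasiCoherent R S.right)) :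
    φ.1 S ψ = F.fn.map (freeAlg.lift (dualLin ψ)) (φ.1 (freeAlg R M) (dualPoint freeAlg.ι)) := by
  refine Eq.trans ?_ (φ.2.2 _ _ (freeAlg.lift (dualLin ψ)) (dualPoint freeAlg.ι))
  refine congrArg (φ.1 S) ?_
  rw [dual_map_dualPoint, algLeft_lift_comp_ι]
  exact (dualPoint_dualLin ψ).symm

/-- The value `φ_{R⟨M⟩}(i_M)` of a morphism `φ : 𝓜^∨ → F`. -/
def evalGeneric (F : RightFunctor.{u, w} R) :
    (quasiCoherent R M).dual.hom F →+ F.extend M :=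
  AddMonoidHom.mk' (fun φ => ⟨φ.1 (freeAlg R M) (dualPoint freeAlg.ι), by
      -- Naturality and right linearity of `φ` reduce the condition to `h_x ∘ i_M = (in ∘ i_M) · x`
      -- in `𝓜^∨`.
      rw [RightFunctor.mem_extend, ← φ.2.2, ← φ.2.2, ← φ.2.1, dual_map_dualPoint,
        dual_map_dualPoint]
      refine congrArg (φ.1 _) ((congrArg dualPoint (LinearMap.ext fun m => ?_)).trans
        (op_smul_dualPoint (freeX R M) _).symm)
      exact (hxHom_ι M m).trans (congrArg (· * freeX R M) (inHom_ι M m).symm)⟩)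
    fun φ φ' => rfl

theorem evalGeneric_injective (F : RightFunctor.{u, w} R) :
    Function.Injective (evalGeneric M F) := by
  intro φ φ' h
  apply Subtype.ext
  funext S
  refine AddMonoidHom.ext fun ψ => ?_
  exact (dual_apply_eq M φ ψ).trans ((congrArg _ (congrArg Subtype.val h)).trans
    (dual_apply_eq M φ' ψ).symm)

variable (N : Type u) [AddCommGroup N] [Module Rᵐᵒᵖ N]

theorem map_lift_toFree {S : RAlg R} (g : M →ₗ[R] S.right) (z : BTensor R N M ⊗[ℤ] R) :
    (quasiCoherentRight R N).fn.map (freeAlg.lift g) (toFree R N M z) =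
      rightActHom (S := S) (BTensor.map (LinearMap.id : N →ₗ[Rᵐᵒᵖ] N) g) z := by
  have := BTensor.tensor_addHom_ext (R := R)
    (f := (BTensor.map LinearMap.id (algLeft (freeAlg.lift g))).comp (toFree R N M))
    (g := rightActHom (S := S) (BTensor.map LinearMap.id g)) fun n m r => by
      refine congrArg (btmul R n)
        (?_ : (freeAlg.lift g).right (freeAlg.ι m * structMap _ r) = g m * structMap S r)
      rw [map_mul, freeAlg.lift_ι, right_structMap]
  exact DFunLike.congr_fun this z

/-- Additivity in `g` can fail for a general `f`, for instance in degree two; here `f` has degree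
one and `map_lift_toFree` applies. -/
theorem map_lift_add {f : (quasiCoherentRight R N).fn.obj (freeAlg R M)}
    (hf : f ∈ (quasiCoherentRight R N).extend M) {S : RAlg R} (g g' : M →ₗ[R] S.right) :
    (quasiCoherentRight R N).fn.map (freeAlg.lift (g + g')) f =
      (quasiCoherentRight R N).fn.map (freeAlg.lift g) f +
        (quasiCoherentRight R N).fn.map (freeAlg.lift g') f := by
  rw [← toFree_degOne_of_mem_extend M N hf, map_lift_toFree, map_lift_toFree, map_lift_toFree,
    BTensor.map_add_right, rightActHom_add]
  rfl

theorem map_lift_smul {F : RightFunctor.{u, w} R} {f : F.fn.obj (freeAlg R M)}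
    (hf : f ∈ F.extend M) {S : RAlg R} (s : S.right) (g : M →ₗ[R] S.right) :
    F.fn.map (freeAlg.lift (rmul S (MulOpposite.op s) ∘ₗ g)) f =
      MulOpposite.op s • F.fn.map (freeAlg.lift g) f := by
  rw [RightFunctor.mem_extend] at hf
  -- The morphism classifying the pair `(g, s)`: it is `g` on `M` and sends `x` to `s`.
  let k : freeAlg R (M × R) ⟶ S :=
    freeAlg.lift (LinearMap.coprod g (LinearMap.toSpanSingleton R S.right s))
  have hk : ∀ m : M, k.right (freeAlg.ι (R := R) (M := M × R) (m, 0)) = g m := fun m => by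
    refine (freeAlg.lift_ι _ ((m, 0) : M × R)).trans ((LinearMap.coprod_apply ..).trans ?_)
    rw [map_zero, add_zero]
  have hx : k.right (freeX R M) = s := by
    refine (freeAlg.lift_ι _ ((0, 1) : M × R)).trans ((LinearMap.coprod_apply ..).trans ?_)
    rw [map_zero, zero_add]
    exact one_smul R s
  have h₁ : hxHom R M ≫ k = freeAlg.lift (rmul S (MulOpposite.op s) ∘ₗ g) :=
    freeAlg.hom_ext fun m => by
      refine (congrArg k.right (hxHom_ι M m)).trans ?_
      rw [map_mul, hk, hx, freeAlg.lift_ι]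
      rfl
  have h₂ : inHom R M ≫ k = freeAlg.lift g :=
    freeAlg.hom_ext fun m => by
      refine (congrArg k.right (inHom_ι M m)).trans ?_
      rw [hk, freeAlg.lift_ι]
  have h := congrArg (F.fn.map k) hf
  rw [F.map_smul, hx] at h
  rw [← h₁, ← h₂, F.fn.map_comp, F.fn.map_comp]
  exact h

theorem evalGeneric_surjective :
    Function.Surjective (evalGeneric M (quasiCoherentRight R N)) := by
  rintro ⟨f, hf⟩
  -- The family that Yoneda attaches to `f`; membership in `𝓝^r(M)` is already needed for its
  -- additivity.
  let φ (S : RAlg R) : (quasiCoherent R M).dual.fn.obj S →+ (quasiCoherentRight R N).fn.obj S :=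
    AddMonoidHom.mk' (fun ψ => (quasiCoherentRight R N).fn.map (freeAlg.lift (dualLin ψ)) f)
      fun ψ ψ' => (congrArg (fun g => (quasiCoherentRight R N).fn.map (freeAlg.lift g) f)
        (dualLin_add ψ ψ')).trans (map_lift_add M N hf _ _)
  have hφ : ∀ {S : RAlg R} (g : M →ₗ[R] S.right), φ S (dualPoint g) =
      (quasiCoherentRight R N).fn.map (freeAlg.lift g) f := fun {S} g =>
    congrArg (fun g => (quasiCoherentRight R N).fn.map (freeAlg.lift g) f) (dualLin_dualPoint g)
  have hsurj : ∀ {S : RAlg R} (ψ : (quasiCoherent R M).dual.fn.obj S),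
      ∃ g : M →ₗ[R] S.right, dualPoint g = ψ := fun {S} ψ => ⟨dualLin ψ, dualPoint_dualLin ψ⟩
  refine ⟨⟨φ, fun S s ψ => ?_, fun S T k ψ => ?_⟩, Subtype.ext ?_⟩
  · obtain ⟨g, rfl⟩ := hsurj ψ
    refine (congrArg (φ S) (op_smul_dualPoint s g)).trans ?_
    rw [hφ, hφ, map_lift_smul M hf]
  · obtain ⟨g, rfl⟩ := hsurj ψ
    rw [dual_map_dualPoint, hφ, hφ]
    have : freeAlg.lift (algLeft k ∘ₗ g) = freeAlg.lift g ≫ k := freeAlg.hom_ext fun m => by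
      rw [freeAlg.lift_ι]
      exact (congrArg k.right (freeAlg.lift_ι g m)).symm
    rw [this, Functor.map_comp]
    rfl
  · refine (hφ freeAlg.ι).trans ?_
    have : freeAlg.lift (freeAlg.ι (R := R) (M := M)) = 𝟙 _ :=
      freeAlg.hom_ext fun m => freeAlg.lift_ι _ m
    rw [this, CategoryTheory.Functor.map_id]
    rfl

end Yoneda

end FunctorModules

theorem theorem5p2 {R : Type u} [Ring R] (M : Type u) [AddCommGroup M] [Module R M]
    (N : Type u) [AddCommGroup N] [Module Rᵐᵒᵖ N] :
    ∃ (e : (FunctorModules.quasiCoherent R M).dual.hom (FunctorModules.quasiCoherentRight R N) ≃+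
          (FunctorModules.quasiCoherentRight R N).extend M)
      (e' : LinearMap.ker (FunctorModules.p₁ R N M - FunctorModules.p₂ R N M) ≃+
          (FunctorModules.quasiCoherentRight R N).extend M),
      (∀ φ, (e φ).1 =
        φ.1 (FunctorModules.freeAlg R M)
          (FunctorModules.dualPoint FunctorModules.freeAlg.ι)) ∧
      (∀ z, (e' z).1 = FunctorModules.toFree R N M z.1) :=
  ⟨AddEquiv.ofBijective (FunctorModules.evalGeneric M (FunctorModules.quasiCoherentRight R N))
      ⟨FunctorModules.evalGeneric_injective M _, FunctorModules.evalGeneric_surjective M N⟩,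
    FunctorModules.kerEquivExtend M N, fun _ => rfl, fun _ => rfl⟩
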